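/- Call an infinite set $S \subseteq \mathbb{N}$ *introreducible* if $S \leq_T T$ for every infinite $T \subseteq S$, and call a function $f : \mathbb{N} \to \mathbb{N}$ a *modulus* for a set $A \subseteq \mathbb{N}$ if $A$ is computable from every function $g : \mathbb{N} \to \mathbb{N}$ with $g(n) \geq f(n)$ for all $n$. There is an infinite $\Delta^0_3$ set $G \subseteq \mathbb{N}$ such that every infinite $G$-computable subset $S$ of $G$ has an infinite subset $T \subseteq S$ with $G \nleq_T T$. Hence $G$ has no introreducible subset of the same Turing degree as $G$; and (extending a result of Slaman and Groszek) $G$ has no modulus of the same Turing degree as $G$. -/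

import Mathlib

/-- The characteristic function of a set of natural numbers, as a (total) oracle `ℕ →. ℕ`. -/
noncomputable def charFun (A : Set ℕ) : ℕ →. ℕ :=
  fun n => Part.some (A.indicator (fun _ => 1) n)

/-- `A ≤_T B` for sets of natural numbers: `A` is computable from `B`. -/
def SetTuringReducible (A B : Set ℕ) : Prop :=
  TuringReducible (charFun A) (charFun B)

/-- `A ≡_T B`: the sets `A` and `B` have the same Turing degree. -/
def SetTuringEquivalent (A B : Set ℕ) : Prop :=
  SetTuringReducible A B ∧ SetTuringReducible B A

/-- `A` is `Σ⁰₃`: it is defined by an `∃∀∃` prefix in front of a computable relation. -/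
def IsSigmaThree (A : Set ℕ) : Prop :=
  ∃ R : ℕ × ℕ × ℕ × ℕ → Prop, ComputablePred R ∧
    ∀ n, n ∈ A ↔ ∃ x, ∀ y, ∃ z, R (n, x, y, z)

/-- `A` is `Π⁰₃`: it is defined by a `∀∃∀` prefix in front of a computable relation. -/
def IsPiThree (A : Set ℕ) : Prop :=
  ∃ R : ℕ × ℕ × ℕ × ℕ → Prop, ComputablePred R ∧
    ∀ n, n ∈ A ↔ ∀ x, ∃ y, ∀ z, R (n, x, y, z)

/-- `A` is `Δ⁰₃`: it is both `Σ⁰₃` and `Π⁰₃`. -/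
def IsDeltaThree (A : Set ℕ) : Prop :=
  IsSigmaThree A ∧ IsPiThree A

/-- An infinite set is introreducible if it is computable from each of its infinite subsets. -/
def IsIntroreducible (S : Set ℕ) : Prop :=
  S.Infinite ∧ ∀ T : Set ℕ, T ⊆ S → T.Infinite → SetTuringReducible S T

/-- `f` is a modulus for `A`: `A` is computable from every function `g` that majorizes `f`. -/
def IsModulus (f : ℕ → ℕ) (A : Set ℕ) : Prop :=
  ∀ g : ℕ → ℕ, (∀ n, f n ≤ g n) → TuringReducible (charFun A) (fun n => Part.some (g n))

-- The set `G` is generic for Mathias forcing with infinite r.e. reservoirs. A condition is a pair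
-- of a finite string `σ` and an r.e. index `x`; later elements of `G` come from the `x`-th r.e.
-- set. Requirement `(e, d, α)` guards against the `d`-th operator enumerating the complement of `G`
-- from every infinite `T` that begins with `α` and lies in the set `S` enumerated by `e` from `G`.
--
-- The core is `exists_forcesOmits`. Suppose that no extension of `σ` makes `e` enumerate a
-- nonelement, confines `e` to a finite set, or lets `d` err along numbers enumerated by `e`. Then
-- repeated extension makes `e` enumerate numbers `n₀ < n₁ < ...`, all elements of the strings
-- built. They form an infinite r.e. set, which becomes the new reservoir, while `n₀` is put outside
-- `G`. If `d` enumerated `n₀` from `α` and finitely many `nᵢ`, a late string of the run would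
-- contain `n₀` and enumerate all those `nᵢ`, so `d` would err there after all.
--
-- Extending a condition and meeting a requirement is a `Σ⁰₃` relation, so `SigmaPred.exists_run`
-- yields a `Δ⁰₃` generic. Given an infinite `S ⊆ G` r.e. in `G`, the set `T` is built by finite
-- extension, defeating one `d` at each stage (`exists_subset_not_enum`). For moduli, this is
-- applied to an `S` so sparse that every infinite subset computes a function majorizing `f`
-- (`EnumGraph.exists_sparse`).

attribute [fun_prop] Computable

namespace Computable

variable {α β γ δ : Type} [Primcodable α] [Primcodable β] [Primcodable γ] [Primcodable δ]

@[fun_prop]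
theorem id_fun : Computable fun a : α => a := Computable.id

@[fun_prop]
theorem const_fun (b : β) : Computable fun _ : α => b := Computable.const b

@[fun_prop]
theorem comp_fun {f : β → γ} {g : α → β} (hf : Computable f) (hg : Computable g) :
    Computable fun a => f (g a) := hf.comp hg

@[fun_prop]
theorem fst_fun {f : α → β × γ} (hf : Computable f) : Computable fun a => (f a).1 :=
  Computable.fst.comp hf

@[fun_prop]
theorem snd_fun {f : α → β × γ} (hf : Computable f) : Computable fun a => (f a).2 :=
  Computable.snd.comp hf

@[fun_prop]
theorem prod_mk_fun {f : α → β} {g : α → γ} (hf : Computable f) (hg : Computable g) :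
    Computable fun a => (f a, g a) := hf.pair hg

@[fun_prop]
theorem append_fun {f g : α → List β} (hf : Computable f) (hg : Computable g) :
    Computable fun a => f a ++ g a := Computable.list_append.comp hf hg

@[fun_prop]
theorem length_fun {f : α → List β} (hf : Computable f) : Computable fun a => (f a).length :=
  Computable.list_length.comp hf

@[fun_prop]
theorem getElem?_fun {f : α → List β} {g : α → ℕ} (hf : Computable f) (hg : Computable g) :
    Computable fun a => (f a)[g a]? := Computable.list_getElem?.comp hf hg

@[fun_prop]
theorem some_fun {f : α → β} (hf : Computable f) : Computable fun a => some (f a) :=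
  Computable.option_some.comp hf

@[fun_prop]
theorem getD_fun {f : α → Option β} {g : α → β} (hf : Computable f) (hg : Computable g) :
    Computable fun a => (f a).getD (g a) := Computable.option_getD hf hg

@[fun_prop]
theorem add_fun {f g : α → ℕ} (hf : Computable f) (hg : Computable g) :
    Computable fun a => f a + g a := Primrec.nat_add.to_comp.comp hf hg

@[fun_prop]
theorem natPair_fun {f g : α → ℕ} (hf : Computable f) (hg : Computable g) :
    Computable fun a => Nat.pair (f a) (g a) := Primrec₂.natPair.to_comp.comp hf hg

@[fun_prop]
theorem unpair_fun {f : α → ℕ} (hf : Computable f) :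
    Computable fun a => Nat.unpair (f a) := Computable.unpair.comp hf

@[fun_prop]
theorem decode_fun {f : α → ℕ} (hf : Computable f) :
    Computable fun a => (Encodable.decode (f a) : Option β) := Computable.decode.comp hf

@[fun_prop]
theorem encode_fun {f : α → β} (hf : Computable f) :
    Computable fun a => Encodable.encode (f a) := Computable.encode.comp hf

end Computable

/-! ### Closure properties of computable predicates. -/

namespace ComputablePred

variable {α β : Type} [Primcodable α] [Primcodable β]

theorem comp {P : β → Prop} (hP : ComputablePred P) {f : α → β} (hf : Computable f) :
    ComputablePred fun a => P (f a) := by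
  obtain ⟨_, h⟩ := hP
  exact ⟨inferInstance, h.comp hf⟩

theorem and {P Q : α → Prop} (hP : ComputablePred P) (hQ : ComputablePred Q) :
    ComputablePred fun a => P a ∧ Q a := by
  obtain ⟨_, hP⟩ := hP
  obtain ⟨_, hQ⟩ := hQ
  exact ⟨inferInstance, (Primrec.and.to_comp.comp hP hQ).of_eq fun a => by simp⟩

theorem or {P Q : α → Prop} (hP : ComputablePred P) (hQ : ComputablePred Q) :
    ComputablePred fun a => P a ∨ Q a :=
  (hP.not.and hQ.not).not.of_eq fun a => by tauto

theorem forall_lt {P : α → ℕ → Prop} (hP : ComputablePred fun q : α × ℕ => P q.1 q.2)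
    {f : α → ℕ} (hf : Computable f) : ComputablePred fun a => ∀ i < f a, P a i := by
  obtain ⟨hd, hP⟩ := hP
  have : ∀ a i, Decidable (P a i) := fun a i => hd (a, i)
  replace hP : Computable fun q : α × ℕ => decide (P q.1 q.2) := by convert! hP
  have h : Computable fun a => Nat.rec (motive := fun _ => Bool) true
      (fun i b => b && decide (P a i)) (f a) :=
    Computable.nat_rec (h := fun a q => q.2 && decide (P a q.1)) hf (Computable.const true)
      (Computable₂.mk (Primrec.and.to_comp.comp (g := fun q : α × ℕ × Bool => q.2.2)
        (h := fun q : α × ℕ × Bool => decide (P q.1 q.2.1)) (by fun_prop)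
        (hP.comp (g := fun q : α × ℕ × Bool => (q.1, q.2.1)) (by fun_prop))))
  refine (ComputablePred.computable_iff.2 ⟨_, h, rfl⟩).of_eq fun a => ?_
  induction f a with
  | zero => simp
  | succ k ih =>
    simp only [Bool.and_eq_true, ih, decide_eq_true_eq, Nat.lt_succ_iff_lt_or_eq]
    constructor
    · rintro ⟨h₁, h₂⟩ i (hi | rfl)
      exacts [h₁ i hi, h₂]
    · exact fun h => ⟨fun i hi => h i (Or.inl hi), h k (Or.inr rfl)⟩

theorem eq [DecidableEq β] {f g : α → β} (hf : Computable f) (hg : Computable g) :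
    ComputablePred fun a => f a = g a :=
  ⟨inferInstance, Primrec.eq.decide.to_comp.comp hf hg⟩

theorem le {f g : α → ℕ} (hf : Computable f) (hg : Computable g) :
    ComputablePred fun a => f a ≤ g a :=
  ⟨inferInstance, Primrec.nat_le.decide.to_comp.comp hf hg⟩

end ComputablePred

/-! ### The arithmetical hierarchy. -/

/-- `Σ⁰ₙ` predicates on a `Primcodable` type; `P` is `Π⁰ₙ` when `fun a => ¬ P a` is `Σ⁰ₙ`. -/
def SigmaPred : ℕ → ∀ {α : Type} [Primcodable α], (α → Prop) → Prop
  | 0, _, _, P => ComputablePred P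
  | n + 1, α, _, P =>
    ∃ Q : α × ℕ → Prop, SigmaPred n Q ∧ ∀ a, P a ↔ ∃ x, ¬ Q (a, x)

namespace SigmaPred

variable {α β γ : Type} [Primcodable α] [Primcodable β] [Primcodable γ] {n : ℕ}

theorem of_iff {P Q : α → Prop} (hP : SigmaPred n P) (h : ∀ a, Q a ↔ P a) : SigmaPred n Q := by
  rwa [show Q = P from funext fun a => propext (h a)]

theorem comp {n : ℕ} {α β : Type} [Primcodable α] [Primcodable β] {P : β → Prop}
    (hP : SigmaPred n P) {f : α → β} (hf : Computable f) : SigmaPred n fun a => P (f a) := by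
  induction n generalizing α β with
  | zero => exact ComputablePred.comp hP hf
  | succ n ih =>
    obtain ⟨Q, hQ, h⟩ := hP
    exact ⟨fun q => Q (f q.1, q.2), ih hQ (f := fun q : α × ℕ => (f q.1, q.2)) (by fun_prop),
      fun a => h (f a)⟩

theorem of_pi {P : α → Prop} (hP : SigmaPred n fun a => ¬ P a) : SigmaPred (n + 1) P :=
  ⟨fun q => ¬ P q.1, hP.comp (f := Prod.fst) (by fun_prop), fun a => by simp⟩

theorem of_computablePred {n : ℕ} {α : Type} [Primcodable α] {P : α → Prop}
    (hP : ComputablePred P) : SigmaPred n P := by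
  induction n generalizing P with
  | zero => exact hP
  | succ n ih => exact of_pi (ih hP.not)

theorem succ {n : ℕ} {α : Type} [Primcodable α] {P : α → Prop} (hP : SigmaPred n P) :
    SigmaPred (n + 1) P := by
  induction n generalizing α with
  | zero => exact of_computablePred hP
  | succ n ih =>
    obtain ⟨Q, hQ, h⟩ := hP
    exact ⟨Q, ih hQ, h⟩

theorem mono {m n : ℕ} (h : m ≤ n) {P : α → Prop} (hP : SigmaPred m P) : SigmaPred n P := by
  induction h with
  | refl => exact hP
  | step _ ih => exact ih.succ

theorem eq [DecidableEq β] {f g : α → β} (hf : Computable f) (hg : Computable g) :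
    SigmaPred n fun a => f a = g a := of_computablePred (.eq hf hg)

theorem ne [DecidableEq β] {f g : α → β} (hf : Computable f) (hg : Computable g) :
    SigmaPred n fun a => f a ≠ g a := of_computablePred (ComputablePred.eq hf hg).not

theorem le {f g : α → ℕ} (hf : Computable f) (hg : Computable g) :
    SigmaPred n fun a => f a ≤ g a := of_computablePred (.le hf hg)

theorem lt {f g : α → ℕ} (hf : Computable f) (hg : Computable g) :
    SigmaPred n fun a => f a < g a :=
  of_computablePred ((ComputablePred.le hg hf).not.of_eq fun a => by simp)

/-- Both closures are proved in one induction because negating the matrix exchanges conjunction and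
disjunction. -/
theorem and_or {n : ℕ} {α : Type} [Primcodable α] {P Q : α → Prop}
    (hP : SigmaPred n P) (hQ : SigmaPred n Q) :
    SigmaPred n (fun a => P a ∧ Q a) ∧ SigmaPred n (fun a => P a ∨ Q a) := by
  induction n generalizing α with
  | zero => exact ⟨ComputablePred.and hP hQ, ComputablePred.or hP hQ⟩
  | succ n ih =>
    obtain ⟨P', hP', h₁⟩ := hP
    obtain ⟨Q', hQ', h₂⟩ := hQ
    refine ⟨⟨fun q => P' (q.1, q.2.unpair.1) ∨ Q' (q.1, q.2.unpair.2),
      (ih (hP'.comp (f := fun q : α × ℕ => (q.1, q.2.unpair.1)) (by fun_prop))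
        (hQ'.comp (f := fun q : α × ℕ => (q.1, q.2.unpair.2)) (by fun_prop))).2, fun a => ?_⟩,
      ⟨fun q => P' q ∧ Q' q, (ih hP' hQ').1, fun a => ?_⟩⟩
    · simp only [h₁, h₂, not_or]
      constructor
      · rintro ⟨⟨x, hx⟩, y, hy⟩
        exact ⟨Nat.pair x y, by simpa using ⟨hx, hy⟩⟩
      · rintro ⟨x, hx, hy⟩
        exact ⟨⟨_, hx⟩, _, hy⟩
    · simp only [h₁, h₂, not_and_or, exists_or]

theorem and {P Q : α → Prop} (hP : SigmaPred n P) (hQ : SigmaPred n Q) :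
    SigmaPred n fun a => P a ∧ Q a := (and_or hP hQ).1

theorem or {P Q : α → Prop} (hP : SigmaPred n P) (hQ : SigmaPred n Q) :
    SigmaPred n fun a => P a ∨ Q a := (and_or hP hQ).2

theorem imp {P Q : α → Prop} (hP : SigmaPred n fun a => ¬ P a) (hQ : SigmaPred n Q) :
    SigmaPred n fun a => P a → Q a := (hP.or hQ).of_iff fun _ => imp_iff_not_or

theorem exists_not [Inhabited β] {P : α → β → Prop}
    (hP : SigmaPred n fun q : α × β => P q.1 q.2) :
    SigmaPred (n + 1) fun a => ∃ b, ¬ P a b := by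
  refine ⟨fun q => P q.1 ((Encodable.decode q.2).getD default),
    hP.comp (f := fun q : α × ℕ => (q.1, ((Encodable.decode q.2 : Option β).getD default)))
      (by fun_prop), fun a => ⟨?_, fun ⟨x, hx⟩ => ⟨_, hx⟩⟩⟩
  rintro ⟨b, hb⟩
  exact ⟨Encodable.encode b, by simpa using hb⟩

theorem ex [Inhabited β] {P : α → β → Prop}
    (hP : SigmaPred (n + 1) fun q : α × β => P q.1 q.2) :
    SigmaPred (n + 1) fun a => ∃ b, P a b := by
  obtain ⟨Q, hQ, h⟩ := hP
  refine (exists_not (β := β × ℕ) (P := fun a q => Q ((a, q.1), q.2))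
    (hQ.comp (f := fun q : α × β × ℕ => ((q.1, q.2.1), q.2.2)) (by fun_prop))).of_iff fun a => ?_
  simp only [fun b => h (a, b), Prod.exists]

/-- The two bounded quantifiers need a joint induction: a list collects one witness for each `i < f
a`, and the negated matrix then carries a bounded existential one level lower. -/
theorem forall_exists_lt {n : ℕ} {α : Type} [Primcodable α] {P : α → ℕ → Prop}
    (hP : SigmaPred n fun q : α × ℕ => P q.1 q.2) {f : α → ℕ} (hf : Computable f) :
    SigmaPred n (fun a => ∀ i < f a, P a i) ∧ SigmaPred n (fun a => ∃ i < f a, P a i) := by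
  induction n generalizing α with
  | zero =>
    exact ⟨ComputablePred.forall_lt hP hf, ((ComputablePred.forall_lt
      (P := fun a i => ¬ P a i) (ComputablePred.not hP) hf).not).of_eq fun a => by simp⟩
  | succ n ih =>
    refine ⟨?_, ex ((lt Computable.snd (by fun_prop)).and hP)⟩
    obtain ⟨Q, hQ, h⟩ := hP
    refine (exists_not (β := List ℕ)
      (P := fun a l => ∃ i < f a, Q ((a, i), l[i]?.getD 0)) (ih (α := α × List ℕ)
        (P := fun q i => Q ((q.1, i), q.2[i]?.getD 0)) (hQ.comp
        (f := fun q : (α × List ℕ) × ℕ => ((q.1.1, q.2), q.1.2[q.2]?.getD 0)) (by fun_prop))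
        (f := fun q => f q.1) (by fun_prop)).2).of_iff fun a => ?_
    simp only [fun i => h (a, i), not_exists, not_and]
    constructor
    · intro h
      choose! g hg using h
      refine ⟨(List.range (f a)).map g, fun i hi => ?_⟩
      simpa [hi] using hg i hi
    · rintro ⟨l, hl⟩ i hi
      exact ⟨_, hl i hi⟩

theorem forall_lt {P : α → ℕ → Prop} (hP : SigmaPred n fun q : α × ℕ => P q.1 q.2)
    {f : α → ℕ} (hf : Computable f) : SigmaPred n fun a => ∀ i < f a, P a i :=
  (forall_exists_lt hP hf).1

end SigmaPred

/-! ### Recursively enumerable sets and their indices. -/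

/-- Membership in the `e`-th recursively enumerable set. -/
def UnivRE (e x : ℕ) : Prop :=
  (Nat.Partrec.Code.eval (Denumerable.ofNat Nat.Partrec.Code e) x).Dom

theorem sigmaPred_univRE : SigmaPred 1 fun q : ℕ × ℕ => UnivRE q.1 q.2 := by
  refine ⟨fun q => ¬ ((Nat.Partrec.Code.evaln q.2 (Denumerable.ofNat _ q.1.1) q.1.2).isSome = true),
    (ComputablePred.computable_iff.2 ⟨_, ?_, rfl⟩ : ComputablePred _).not, fun q => ?_⟩
  · exact Primrec.option_isSome.to_comp.comp (Nat.Partrec.Code.primrec_evaln.to_comp.comp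
      (g := fun q : (ℕ × ℕ) × ℕ => ((q.2, Denumerable.ofNat Nat.Partrec.Code q.1.1), q.1.2))
      ((Computable.snd.pair ((Computable.ofNat _).comp (by fun_prop))).pair (by fun_prop)))
  · simp only [UnivRE, Part.dom_iff_mem, Nat.Partrec.Code.evaln_complete, not_not,
      Option.isSome_iff_exists, Option.mem_def]
    exact exists_comm

theorem SigmaPred.exists_univRE {α : Type} [Primcodable α] {P : α → Prop} (hP : SigmaPred 1 P) :
    ∃ e, ∀ a, P a ↔ UnivRE e (Encodable.encode a) := by
  obtain ⟨Q, hQ, h⟩ := hP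
  obtain ⟨_, hQ⟩ := hQ
  have hr : Partrec fun a => Nat.rfind fun x => (Part.some (! decide (Q (a, x))) : Part Bool) :=
    Partrec.rfind (Computable.partrec (Primrec.not.to_comp.comp hQ))
  obtain ⟨c, hc⟩ := Nat.Partrec.Code.exists_code.1 hr
  refine ⟨Encodable.encode c, fun a => ?_⟩
  rw [h, UnivRE, Denumerable.ofNat_encode, hc]
  simp only [Encodable.encodek, Part.coe_some, Part.bind_some, Part.map_Dom]
  refine Iff.trans ?_ Nat.rfind_dom'.symm
  simp

/-! ### Strings and initial segments. -/

/-- The initial segment of length `N` of the characteristic function of `A`. -/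
noncomputable def initSeg (A : Set ℕ) (N : ℕ) : List Bool :=
  open Classical in (List.range N).map fun i => decide (i ∈ A)

@[simp]
theorem initSeg_length (A : Set ℕ) (N : ℕ) : (initSeg A N).length = N := by
  simp [initSeg]

theorem initSeg_getElem? (A : Set ℕ) (N i : ℕ) (b : Bool) :
    (initSeg A N)[i]? = some b ↔ i < N ∧ (b = true ↔ i ∈ A) := by
  classical
  by_cases h : i < N
  · cases b <;> simp [initSeg, h]
  · simp [initSeg, h]

theorem initSeg_add (A : Set ℕ) (N M : ℕ) : ∃ β, initSeg A (N + M) = initSeg A N ++ β := by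
  simp only [initSeg, List.range_add, List.map_append]
  exact ⟨_, rfl⟩

theorem initSeg_eq_append {A : Set ℕ} {N : ℕ} {ρ β : List Bool} (h : initSeg A N = ρ ++ β) :
    ρ = initSeg A ρ.length := by
  have hl : ρ.length ≤ N := by
    have := congrArg List.length h
    simp at this
    omega
  obtain ⟨M, rfl⟩ := Nat.exists_eq_add_of_le hl
  obtain ⟨γ, hγ⟩ := initSeg_add A ρ.length M
  exact (List.append_inj_left (hγ ▸ h) (by simp)).symm

/-- The union of a chain of strings. -/
def stringUnion (s : ℕ → List Bool) : Set ℕ := {n | ∃ k, (s k)[n]? = some true}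

theorem eq_initSeg_stringUnion {s : ℕ → List Bool} (hs : ∀ k, s k <+: s (k + 1)) (k : ℕ) :
    s k = initSeg (stringUnion s) (s k).length := by
  have hpre : ∀ k j, s k <+: s (k + j) := by
    intro k j
    induction j with
    | zero => exact List.prefix_rfl
    | succ j ih => exact ih.trans (hs (k + j))
  have hmono : ∀ (k j n : ℕ) (b : Bool), (s k)[n]? = some b → (s (k + j))[n]? = some b := by
    intro k j n b h
    obtain ⟨γ, hγ⟩ := hpre k j
    rwa [← hγ, List.getElem?_append_left (List.getElem?_eq_some_iff.1 h).1]
  refine List.ext_getElem? fun i => ?_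
  by_cases hi : i < (s k).length
  · have hk := List.getElem?_eq_getElem hi
    rw [hk]
    refine ((initSeg_getElem? _ _ _ _).2 ⟨hi, ?_⟩).symm
    refine ⟨fun h => ⟨k, by rw [hk, h]⟩, fun ⟨j, hj⟩ => ?_⟩
    have h₁ := hmono k j i _ hk
    have h₂ := hmono j k i _ hj
    rw [add_comm] at h₂
    simpa [h₁] using h₂
  · rw [List.getElem?_eq_none (by omega), List.getElem?_eq_none (by simp; omega)]

/-! ### From Turing reductions to enumeration along initial segments. -/

/-- The graph of `f` is enumerated, uniformly along the initial segments of `A`, by a `Σ⁰₁`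
predicate that is closed under extension of strings. -/
def EnumGraph (A : Set ℕ) (f : ℕ →. ℕ) : Prop :=
  ∃ V : List Bool → ℕ → ℕ → Prop,
    SigmaPred 1 (fun q : List Bool × ℕ × ℕ => V q.1 q.2.1 q.2.2) ∧
    (∀ ρ β n v, V ρ n v → V (ρ ++ β) n v) ∧
    ∀ n v, v ∈ f n ↔ ∃ N, V (initSeg A N) n v

open Filter

/-- Monotonicity turns "some `N`" into "all large `N`", so finitely many oracle computations share
one initial segment. -/
theorem eventually_initSeg {A : Set ℕ} {P : List Bool → Prop} (hP : ∀ ρ β, P ρ → P (ρ ++ β)) :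
    (∃ N, P (initSeg A N)) ↔ ∀ᶠ N in atTop, P (initSeg A N) := by
  refine ⟨fun ⟨N, hN⟩ => eventually_atTop.2 ⟨N, fun M hM => ?_⟩, fun h => h.exists⟩
  obtain ⟨K, rfl⟩ := Nat.exists_eq_add_of_le hM
  obtain ⟨β, hβ⟩ := initSeg_add A N K
  exact hβ ▸ hP _ _ hN

theorem SigmaPred.comp₃ {n : ℕ} {α : Type} [Primcodable α] {V : List Bool → ℕ → ℕ → Prop}
    (hV : SigmaPred n fun q : List Bool × ℕ × ℕ => V q.1 q.2.1 q.2.2) {f : α → List Bool}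
    {g h : α → ℕ} (hf : Computable f) (hg : Computable g) (hh : Computable h) :
    SigmaPred n fun a => V (f a) (g a) (h a) :=
  hV.comp (f := fun a => (f a, g a, h a)) (by fun_prop)

theorem eventually_of_mem {A : Set ℕ} {f : ℕ →. ℕ} {V : List Bool → ℕ → ℕ → Prop}
    (hV : ∀ ρ β n v, V ρ n v → V (ρ ++ β) n v) (hf : ∀ n v, v ∈ f n ↔ ∃ N, V (initSeg A N) n v)
    {n v : ℕ} (h : v ∈ f n) : ∀ᶠ N in atTop, V (initSeg A N) n v :=
  (eventually_initSeg (P := fun ρ => V ρ n v) fun _ _ => hV _ _ _ _).1 ((hf _ _).1 h)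

namespace EnumGraph

variable {A : Set ℕ} {f h : ℕ →. ℕ}

theorem of_computable {g : ℕ → ℕ} (hg : Computable g) : EnumGraph A fun n => Part.some (g n) :=
  ⟨fun _ n v => v = g n, .eq (by fun_prop) (by fun_prop), fun _ _ _ _ => id, fun n v => by simp⟩

theorem charFun_self : EnumGraph A (charFun A) := by
  refine ⟨fun ρ n v => (ρ[n]? = some true ∧ v = 1) ∨ (ρ[n]? = some false ∧ v = 0), ?_, ?_, ?_⟩
  · exact .or (.and (.eq (by fun_prop) (by fun_prop)) (.eq (by fun_prop) (by fun_prop)))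
      (.and (.eq (by fun_prop) (by fun_prop)) (.eq (by fun_prop) (by fun_prop)))
  · rintro ρ β n v (⟨h, hv⟩ | ⟨h, hv⟩)
    · exact .inl ⟨List.getElem?_append_left (List.getElem?_eq_some_iff.1 h).1 ▸ h, hv⟩
    · exact .inr ⟨List.getElem?_append_left (List.getElem?_eq_some_iff.1 h).1 ▸ h, hv⟩
  · intro n v
    simp only [charFun, Part.mem_some_iff, initSeg_getElem?]
    by_cases hn : n ∈ A
    · simp [hn, exists_gt]
    · simp [hn, exists_gt]

theorem pair (hf : EnumGraph A f) (hh : EnumGraph A h) :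
    EnumGraph A fun n => (Nat.pair <$> f n <*> h n) := by
  obtain ⟨V, hV, hVm, hVf⟩ := hf
  obtain ⟨W, hW, hWm, hWh⟩ := hh
  refine ⟨fun ρ n v => ∃ p : ℕ × ℕ, V ρ n p.1 ∧ W ρ n p.2 ∧ v = Nat.pair p.1 p.2, ?_, ?_, ?_⟩
  · exact .ex (.and (hV.comp₃ (by fun_prop) (by fun_prop) (by fun_prop))
      (.and (hW.comp₃ (by fun_prop) (by fun_prop) (by fun_prop))
        (.eq (by fun_prop) (by fun_prop))))
  · rintro ρ β n v ⟨p, h₁, h₂, h₃⟩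
    exact ⟨p, hVm _ _ _ _ h₁, hWm _ _ _ _ h₂, h₃⟩
  · intro n v
    simp only [Seq.seq, Part.map_eq_map, Part.mem_bind_iff, Part.mem_map_iff]
    constructor
    · rintro ⟨_, ⟨a, ha, rfl⟩, b, hb, rfl⟩
      obtain ⟨N, h₁, h₂⟩ := ((eventually_of_mem hVm hVf ha).and
        (eventually_of_mem hWm hWh hb)).exists
      exact ⟨N, (a, b), h₁, h₂, rfl⟩
    · rintro ⟨N, p, h₁, h₂, rfl⟩
      exact ⟨_, ⟨_, (hVf _ _).2 ⟨N, h₁⟩, rfl⟩, _, (hWh _ _).2 ⟨N, h₂⟩, rfl⟩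

theorem comp (hf : EnumGraph A f) (hh : EnumGraph A h) : EnumGraph A fun n => h n >>= f := by
  obtain ⟨V, hV, hVm, hVf⟩ := hf
  obtain ⟨W, hW, hWm, hWh⟩ := hh
  refine ⟨fun ρ n v => ∃ a, W ρ n a ∧ V ρ a v, ?_, ?_, ?_⟩
  · exact .ex (.and (hW.comp₃ (by fun_prop) (by fun_prop) (by fun_prop))
      (hV.comp₃ (by fun_prop) (by fun_prop) (by fun_prop)))
  · rintro ρ β n v ⟨p, h₁, h₂⟩
    exact ⟨p, hWm _ _ _ _ h₁, hVm _ _ _ _ h₂⟩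
  · intro n v
    refine (Part.mem_bind_iff (f := h n) (g := f)).trans ?_
    constructor
    · rintro ⟨a, ha, hb⟩
      obtain ⟨N, h₁, h₂⟩ := ((eventually_of_mem hWm hWh ha).and
        (eventually_of_mem hVm hVf hb)).exists
      exact ⟨N, a, h₁, h₂⟩
    · rintro ⟨N, a, h₁, h₂⟩
      exact ⟨a, (hWh _ _).2 ⟨N, h₁⟩, (hVf _ _).2 ⟨N, h₂⟩⟩

theorem rfind (hf : EnumGraph A f) :
    EnumGraph A fun a => Nat.rfind fun n => (f (Nat.pair a n)).map fun m => decide (m = 0) := by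
  obtain ⟨V, hV, hVm, hVf⟩ := hf
  refine ⟨fun ρ n v => V ρ (Nat.pair n v) 0 ∧ ∀ i < v, ∃ w, w ≠ 0 ∧ V ρ (Nat.pair n i) w,
    ?_, ?_, ?_⟩
  · refine .and (hV.comp₃ (by fun_prop) (by fun_prop) (by fun_prop))
      (SigmaPred.forall_lt (.ex ?_) (by fun_prop))
    exact .and (.ne (by fun_prop) (by fun_prop))
      (hV.comp₃ (by fun_prop) (by fun_prop) (by fun_prop))
  · rintro ρ β n v ⟨h₁, h₂⟩
    refine ⟨hVm _ _ _ _ h₁, fun i hi => ?_⟩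
    obtain ⟨w, hw, h⟩ := h₂ i hi
    exact ⟨w, hw, hVm _ _ _ _ h⟩
  · intro n v
    refine Nat.mem_rfind.trans ?_
    simp only [Part.mem_map_iff]
    constructor
    · rintro ⟨⟨a, ha, h₁⟩, h₂⟩
      obtain rfl : a = 0 := by simpa using h₁
      have h₃ : ∀ i ∈ Set.Iio v, ∀ᶠ N in atTop, ∃ w, w ≠ 0 ∧ V (initSeg A N) (Nat.pair n i) w := by
        intro i hi
        obtain ⟨w, hw, h⟩ := h₂ hi
        filter_upwards [eventually_of_mem hVm hVf hw] with N hN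
        exact ⟨w, by simpa using h, hN⟩
      obtain ⟨N, h₄, h₅⟩ := ((eventually_of_mem hVm hVf ha).and
        ((eventually_all_finite (Set.finite_Iio v)).2 h₃)).exists
      exact ⟨N, h₄, h₅⟩
    · rintro ⟨N, h₁, h₂⟩
      refine ⟨⟨0, (hVf _ _).2 ⟨N, h₁⟩, by simp⟩, fun {m} hm => ?_⟩
      obtain ⟨w, hw, h⟩ := h₂ m hm
      exact ⟨w, (hVf _ _).2 ⟨N, h⟩, by simpa using hw⟩

theorem prec (hf : EnumGraph A f) (hh : EnumGraph A h) :
    EnumGraph A fun p => Nat.rec (motive := fun _ => Part ℕ) (f (Nat.unpair p).1)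
      (fun y IH => IH.bind fun i => h (Nat.pair (Nat.unpair p).1 (Nat.pair y i)))
      (Nat.unpair p).2 := by
  obtain ⟨V, hV, hVm, hVf⟩ := hf
  obtain ⟨W, hW, hWm, hWh⟩ := hh
  -- The list `l` records the successive values of the recursion; out-of-range entries read as 0.
  refine ⟨fun ρ p v => ∃ l : List ℕ, V ρ p.unpair.1 (l[0]?.getD 0) ∧
    (∀ i < p.unpair.2, W ρ (Nat.pair p.unpair.1 (Nat.pair i (l[i]?.getD 0))) (l[i + 1]?.getD 0)) ∧
    v = l[p.unpair.2]?.getD 0, ?_, ?_, ?_⟩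
  · refine .ex (.and (hV.comp₃ (by fun_prop) (by fun_prop) (by fun_prop))
      (.and (SigmaPred.forall_lt ?_ (by fun_prop)) (.eq (by fun_prop) (by fun_prop))))
    exact hW.comp₃ (by fun_prop) (by fun_prop) (by fun_prop)
  · rintro ρ β n v ⟨l, h₁, h₂, h₃⟩
    exact ⟨l, hVm _ _ _ _ h₁, fun i hi => hWm _ _ _ _ (h₂ i hi), h₃⟩
  · intro p v
    beta_reduce
    change v ∈ Nat.rec (motive := fun _ => Part ℕ) (f (Nat.unpair p).1)
      (fun y IH => IH.bind fun i => h (Nat.pair (Nat.unpair p).1 (Nat.pair y i)))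
      (Nat.unpair p).2 ↔ _
    generalize p.unpair.1 = a
    generalize p.unpair.2 = k
    constructor
    · intro hv
      -- Fixing the length at `k + 1` ensures that appending the next value puts it at index `k +
      -- 1`.
      suffices H : ∀ᶠ N in atTop, ∃ l : List ℕ, l.length = k + 1 ∧
          V (initSeg A N) a (l[0]?.getD 0) ∧
          (∀ i < k, W (initSeg A N) (Nat.pair a (Nat.pair i (l[i]?.getD 0)))
            (l[i + 1]?.getD 0)) ∧ v = l[k]?.getD 0 by
        obtain ⟨N, l, -, h⟩ := H.exists
        exact ⟨N, l, h⟩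
      induction k generalizing v with
      | zero =>
        filter_upwards [eventually_of_mem hVm hVf hv] with N hN
        exact ⟨[v], by simpa using hN⟩
      | succ k ih =>
        simp only [Part.mem_bind_iff] at hv
        obtain ⟨w, hw, hv⟩ := hv
        filter_upwards [ih w hw,
          eventually_of_mem hWm hWh hv] with N ⟨l, hl, h₁, h₂, h₃⟩ h₄
        refine ⟨l ++ [v], by simp [hl], ?_, fun i hi => ?_, by simp [← hl]⟩
        · rwa [List.getElem?_append_left (by omega)]
        · rw [List.getElem?_append_left (by omega)]
          rcases Nat.lt_succ_iff_lt_or_eq.1 hi with hi | rfl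
          · rw [List.getElem?_append_left (by omega)]
            exact h₂ i hi
          · simpa [← h₃, ← hl] using h₄
    · rintro ⟨N, l, h₁, h₂, rfl⟩
      induction k with
      | zero => exact (hVf _ _).2 ⟨N, h₁⟩
      | succ k ih =>
        simp only [Part.mem_bind_iff]
        exact ⟨_, ih fun i hi => h₂ i (by omega), (hWh _ _).2 ⟨N, h₂ k (by omega)⟩⟩

theorem of_recursiveIn {O : Set (ℕ →. ℕ)} (hO : ∀ g ∈ O, EnumGraph A g)
    (hf : Nat.RecursiveIn O f) : EnumGraph A f := by
  induction hf with
  | zero => exact of_computable (Computable.const 0)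
  | succ => exact of_computable Computable.succ
  | left => exact of_computable (by fun_prop)
  | right => exact of_computable (by fun_prop)
  | oracle g hg => exact hO g hg
  | pair _ _ h₁ h₂ => exact h₁.pair h₂
  | comp _ _ h₁ h₂ => exact h₁.comp h₂
  | prec _ _ h₁ h₂ => exact h₁.prec h₂
  | rfind _ h => exact h.rfind

theorem of_turingReducible (hf : TuringReducible f h) (hh : EnumGraph A h) : EnumGraph A f :=
  of_recursiveIn (by simpa using hh) (RecursiveIn.iff_nat.1 hf)

end EnumGraph

/-! ### Definable runs of a step relation. -/

/-- Dependent choice with control of complexity: a `Σ⁰ₙ₊₁` step relation that is total on the good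
states has a run whose graph is `Σ⁰ₙ₊₁`. -/
theorem SigmaPred.exists_run {n : ℕ} {C : Type} [Primcodable C] [Inhabited C] [DecidableEq C]
    {Step : ℕ → C → C → Prop} (hStep : SigmaPred (n + 1) fun q : ℕ × C × C => Step q.1 q.2.1 q.2.2)
    {Good : C → Prop} (hex : ∀ k c, Good c → ∃ c', Step k c c')
    (hgood : ∀ k c c', Good c → Step k c c' → Good c') {c₀ : C} (h₀ : Good c₀) :
    ∃ s : ℕ → C, s 0 = c₀ ∧ (∀ k, Good (s k)) ∧ (∀ k, Step k (s k) (s (k + 1))) ∧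
      SigmaPred (n + 1) fun q : ℕ × C => s q.1 = q.2 := by
  obtain ⟨Q, hQ, h⟩ := hStep
  let dec : ℕ → C × ℕ := fun y => (Encodable.decode y : Option (C × ℕ)).getD default
  have hdec : Computable dec := by fun_prop
  -- `y` is the least code of a successor together with a witness for it. This makes the choice
  -- single-valued and stays `Σ⁰ₙ₊₁`: a `Πₙ` clause and a bounded quantifier over `Σₙ`.
  let L : ℕ → C → ℕ → Prop := fun k c y =>
    ¬ Q ((k, c, (dec y).1), (dec y).2) ∧ ∀ j < y, Q ((k, c, (dec j).1), (dec j).2)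
  have hL : SigmaPred (n + 1) fun q : ℕ × C × ℕ => L q.1 q.2.1 q.2.2 := by
    have h₁ : SigmaPred n fun q : ℕ × C × ℕ => Q ((q.1, q.2.1, (dec q.2.2).1), (dec q.2.2).2) :=
      hQ.comp (f := fun q : ℕ × C × ℕ => ((q.1, q.2.1, (dec q.2.2).1), (dec q.2.2).2))
        (by fun_prop)
    refine (of_pi (by simpa only [not_not] using h₁)).and (SigmaPred.forall_lt ?_ (by fun_prop))
    exact (h₁.comp (f := fun q : (ℕ × C × ℕ) × ℕ => (q.1.1, q.1.2.1, q.2)) (by fun_prop)).succ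
  have hLu : ∀ k c y z, L k c y → L k c z → y = z := by
    intro k c y z hy hz
    rcases lt_trichotomy y z with hlt | rfl | hlt
    exacts [absurd (hz.2 y hlt) hy.1, rfl, absurd (hy.2 z hlt) hz.1]
  have hLex : ∀ k c, Good c → ∃ y, L k c y := by
    classical
    intro k c hc
    obtain ⟨c', hc'⟩ := hex k c hc
    obtain ⟨x, hx⟩ := (h (k, c, c')).1 hc'
    have hy : ∃ y, ¬ Q ((k, c, (dec y).1), (dec y).2) :=
      ⟨Encodable.encode (c', x), by simpa [dec] using hx⟩
    exact ⟨Nat.find hy, Nat.find_spec hy, fun j hj => not_not.1 (Nat.find_min hy hj)⟩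
  choose! F hF using hLex
  have hFStep : ∀ k c, Good c → Step k c (dec (F k c)).1 := fun k c hc =>
    (h (k, c, _)).2 ⟨_, (hF k c hc).1⟩
  let s : ℕ → C := fun k => Nat.rec c₀ (fun k c => (dec (F k c)).1) k
  have hs : ∀ k, Good (s k) := by
    intro k
    induction k with
    | zero => exact h₀
    | succ k ih => exact hgood k _ _ ih (hFStep k _ ih)
  refine ⟨s, rfl, hs, fun k => hFStep k _ (hs k), ?_⟩
  have hrun : SigmaPred (n + 1) fun q : ℕ × C => ∃ l : List C, l[0]?.getD default = c₀ ∧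
      (∀ i < q.1, ∃ y, L i (l[i]?.getD default) y ∧ l[i + 1]?.getD default = (dec y).1) ∧
      l[q.1]?.getD default = q.2 := by
    refine .ex (.and (.eq (by fun_prop) (by fun_prop)) (.and
      (SigmaPred.forall_lt (.ex ?_) (by fun_prop)) (.eq (by fun_prop) (by fun_prop))))
    refine .and ?_ (.eq (by fun_prop) (by fun_prop))
    exact hL.comp (f := fun q : (((ℕ × C) × List C) × ℕ) × ℕ =>
      (q.1.2, q.1.1.2[q.1.2]?.getD default, q.2)) (by fun_prop)
  refine hrun.of_iff fun ⟨k, c⟩ => ?_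
  dsimp only
  constructor
  · rintro rfl
    refine ⟨(List.range (k + 1)).map s, by simp [s], fun i hi => ⟨F i (s i), ?_, ?_⟩, by simp⟩
    · simpa [show i < k + 1 by omega] using hF i _ (hs i)
    · simp [hi, s]
  · rintro ⟨l, hl₀, hl, rfl⟩
    have : ∀ i ≤ k, s i = l[i]?.getD default := by
      intro i hi
      induction i with
      | zero => exact hl₀.symm
      | succ i ih =>
        obtain ⟨y, hy, hy'⟩ := hl i hi
        rw [hy', ← hLu _ _ _ _ (ih (by omega) ▸ hF i _ (hs i)) hy, ← ih (by omega)]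
    exact this k le_rfl

/-! ### Conditions, requirements and the forcing relation. -/

/-- `n` is enumerated by the `e`-th enumeration operator with the string `ρ` as oracle. -/
def EnumBy (e : ℕ) (ρ : List Bool) (n : ℕ) : Prop :=
  ∃ q : List Bool × List Bool, ρ = q.1 ++ q.2 ∧ UnivRE e (Encodable.encode (q.1, n))

/-- The string `β`, read from position `k` on, is the characteristic function of a subset of `P`. -/
def ShiftSub (P : ℕ → Prop) (k : ℕ) (β : List Bool) : Prop :=
  ∀ i < β.length, β[i]? = some true → P (k + i)

/-- `ρ` extends `σ`, and the new elements come from the `x`-th recursively enumerable set. -/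
def StringExt (x : ℕ) (σ ρ : List Bool) : Prop :=
  ∃ β, ρ = σ ++ β ∧ ShiftSub (UnivRE x) σ.length β

theorem EnumBy.append {e n : ℕ} {ρ : List Bool} (h : EnumBy e ρ n) (β : List Bool) :
    EnumBy e (ρ ++ β) n := by
  obtain ⟨⟨ρ₁, ρ₂⟩, rfl, h⟩ := h
  exact ⟨(ρ₁, ρ₂ ++ β), by simp, h⟩

theorem StringExt.refl (x : ℕ) (σ : List Bool) : StringExt x σ σ :=
  ⟨[], by simp, fun i hi => by simp at hi⟩

theorem StringExt.trans {x : ℕ} {σ ρ τ : List Bool} (h₁ : StringExt x σ ρ)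
    (h₂ : StringExt x ρ τ) : StringExt x σ τ := by
  obtain ⟨β, rfl, hβ⟩ := h₁
  obtain ⟨γ, rfl, hγ⟩ := h₂
  refine ⟨β ++ γ, by simp, fun i hi h => ?_⟩
  by_cases hlt : i < β.length
  · exact hβ i hlt (by rwa [List.getElem?_append_left hlt] at h)
  · rw [List.getElem?_append_right (by omega)] at h
    have := hγ (i - β.length) (by simp at hi; omega) h
    rwa [List.length_append, show σ.length + β.length + (i - β.length) = σ.length + i by omega]
      at this

theorem StringExt.replicate_false (x : ℕ) (σ : List Bool) (n : ℕ) :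
    StringExt x σ (σ ++ List.replicate n false) :=
  ⟨_, rfl, fun i hi h => by simp [List.getElem?_replicate] at h⟩

theorem StringExt.concat_true {x y : ℕ} {σ : List Bool} (hy : σ.length ≤ y) (h : UnivRE x y) :
    StringExt x σ (σ ++ (List.replicate (y - σ.length) false ++ [true])) := by
  refine ⟨_, rfl, fun i hi h' => ?_⟩
  by_cases hlt : i < y - σ.length
  · rw [List.getElem?_append_left (by simpa)] at h'
    simp [List.getElem?_replicate] at h'
  · simp at hi
    rwa [show σ.length + i = y by omega]

theorem StringExt.univRE {x n : ℕ} {σ ρ : List Bool} (h : StringExt x σ ρ) (hn : σ.length ≤ n)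
    (hρ : ρ[n]? = some true) : UnivRE x n := by
  obtain ⟨β, rfl, hβ⟩ := h
  rw [List.getElem?_append_right hn] at hρ
  have := hβ (n - σ.length) (List.getElem?_eq_some_iff.1 hρ).1 hρ
  rwa [show σ.length + (n - σ.length) = n by omega] at this

theorem StringExt.mono {x x' : ℕ} {σ ρ : List Bool} (h : StringExt x' σ ρ)
    (hx : ∀ y, UnivRE x' y → UnivRE x y) : StringExt x σ ρ := by
  obtain ⟨β, rfl, hβ⟩ := h
  exact ⟨β, rfl, fun i hi h => hx _ (hβ i hi h)⟩

theorem StringExt.getElem? {x n : ℕ} {σ ρ : List Bool} {b : Bool} (h : StringExt x σ ρ)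
    (hn : σ[n]? = some b) : ρ[n]? = some b := by
  obtain ⟨β, rfl, hβ⟩ := h
  rwa [List.getElem?_append_left (List.getElem?_eq_some_iff.1 hn).1]

theorem EnumBy.stringExt {e n x : ℕ} {σ ρ : List Bool} (h : EnumBy e σ n)
    (hρ : StringExt x σ ρ) : EnumBy e ρ n := by
  obtain ⟨β, rfl, hβ⟩ := hρ
  exact h.append β

/-- The string `σ` forces the `e`-th enumeration operator to enumerate a nonelement. -/
def ForcesNotSubset (e : ℕ) (σ : List Bool) : Prop :=
  ∃ n, σ[n]? = some false ∧ EnumBy e σ n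

/-- The condition `(σ, x)` forces the `e`-th enumeration operator to enumerate a finite set. -/
def ForcesFinite (e : ℕ) (σ : List Bool) (x : ℕ) : Prop :=
  ∃ k, ¬ ∃ q : ℕ × List Bool, k ≤ q.1 ∧ StringExt x σ q.2 ∧ EnumBy e q.2 q.1

/-- Some extension of `α` by elements enumerated by `e` along `σ` makes the `d`-th operator
enumerate an element of `σ`. -/
def ForcesWrong (e d : ℕ) (α σ : List Bool) : Prop :=
  ∃ q : List Bool × ℕ, ShiftSub (EnumBy e σ) α.length q.1 ∧ EnumBy d (α ++ q.1) q.2 ∧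
    σ[q.2]? = some true

/-- Some nonelement of `σ` is not enumerated by the `d`-th operator along any extension of `α` by
elements of the `x`-th recursively enumerable set. -/
def ForcesOmits (d : ℕ) (α σ : List Bool) (x : ℕ) : Prop :=
  ∃ m, σ[m]? = some false ∧ ¬ ∃ ρ, StringExt x α ρ ∧ EnumBy d ρ m

/-- One of the four ways to meet the requirement `r = (e, d, α)`. -/
def Forces (r : ℕ × ℕ × List Bool) (σ : List Bool) (x : ℕ) : Prop :=
  ForcesNotSubset r.1 σ ∨ ForcesFinite r.1 σ x ∨ ForcesWrong r.1 r.2.1 r.2.2 σ ∨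
    ForcesOmits r.2.1 r.2.2 σ x

/-- The requirement with number `k`. -/
def requirement (k : ℕ) : ℕ × ℕ × List Bool :=
  (Encodable.decode k : Option (ℕ × ℕ × List Bool)).getD default

/-- The `x`-th recursively enumerable set is infinite. -/
def InfiniteRE (x : ℕ) : Prop := ∀ b, ∃ y, b ≤ y ∧ UnivRE x y

/-- The condition `c'` extends `c`, adds an element, and meets the `k`-th requirement. -/
def GenericStep (k : ℕ) (c c' : List Bool × ℕ) : Prop :=
  StringExt c.2 c.1 c'.1 ∧ (∃ i, c.1.length ≤ i ∧ c'.1[i]? = some true) ∧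
    (∀ y, UnivRE c'.2 y → UnivRE c.2 y) ∧ InfiniteRE c'.2 ∧ Forces (requirement k) c'.1 c'.2

section Complexity

variable {α : Type} [Primcodable α] {e x k : α → ℕ} {σ ρ : α → List Bool}

theorem sigmaPred_univRE_comp (he : Computable e) (hk : Computable k) :
    SigmaPred 1 fun a => UnivRE (e a) (k a) :=
  sigmaPred_univRE.comp (f := fun a => (e a, k a)) (by fun_prop)

theorem sigmaPred_enumBy (he : Computable e) (hσ : Computable σ) (hk : Computable k) :
    SigmaPred 1 fun a => EnumBy (e a) (σ a) (k a) :=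
  .ex (.and (.eq (by fun_prop) (by fun_prop)) (sigmaPred_univRE_comp (by fun_prop) (by fun_prop)))

theorem sigmaPred_shiftSub {n : ℕ} {P : α → ℕ → Prop}
    (hP : SigmaPred n fun q : α × ℕ => P q.1 q.2) (hk : Computable k) (hσ : Computable σ) :
    SigmaPred n fun a => ShiftSub (P a) (k a) (σ a) := by
  refine SigmaPred.forall_lt (.imp (.ne (by fun_prop) (by fun_prop)) ?_) (by fun_prop)
  exact hP.comp (f := fun q : α × ℕ => (q.1, k q.1 + q.2)) (by fun_prop)

theorem sigmaPred_stringExt (hx : Computable x) (hσ : Computable σ) (hρ : Computable ρ) :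
    SigmaPred 1 fun a => StringExt (x a) (σ a) (ρ a) := by
  refine .ex (.and (.eq (by fun_prop) (by fun_prop)) (sigmaPred_shiftSub ?_ ?_ ?_))
  exacts [sigmaPred_univRE_comp (by fun_prop) (by fun_prop), by fun_prop, by fun_prop]

theorem sigmaPred_forces {r : α → ℕ × ℕ × List Bool} (hr : Computable r) (hσ : Computable σ)
    (hx : Computable x) : SigmaPred 2 fun a => Forces (r a) (σ a) (x a) := by
  refine .or ?_ (.or ?_ (.or ?_ ?_))
  · refine (SigmaPred.ex ?_).succ
    exact .and (.eq (by fun_prop) (by fun_prop))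
      (sigmaPred_enumBy (by fun_prop) (by fun_prop) (by fun_prop))
  · exact .exists_not (.ex (.and (.le (by fun_prop) (by fun_prop))
      (.and (sigmaPred_stringExt (by fun_prop) (by fun_prop) (by fun_prop))
        (sigmaPred_enumBy (by fun_prop) (by fun_prop) (by fun_prop)))))
  · refine (SigmaPred.ex ?_).succ
    refine .and (sigmaPred_shiftSub ?_ ?_ ?_)
      (.and (sigmaPred_enumBy (by fun_prop) (by fun_prop) (by fun_prop))
        (.eq (by fun_prop) (by fun_prop)))
    exacts [sigmaPred_enumBy (by fun_prop) (by fun_prop) (by fun_prop), by fun_prop, by fun_prop]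
  · refine .ex (.and (.eq (by fun_prop) (by fun_prop)) (.of_pi ?_))
    simp only [not_not]
    exact .ex (.and (sigmaPred_stringExt (by fun_prop) (by fun_prop) (by fun_prop))
        (sigmaPred_enumBy (by fun_prop) (by fun_prop) (by fun_prop)))

end Complexity

theorem computable_requirement : Computable requirement := by
  unfold requirement
  fun_prop

/-- The costly clauses are inclusion and infinitude of reservoirs, both `Π⁰₂`; forcing itself is
`Σ⁰₂`. -/
theorem sigmaPred_genericStep :
    SigmaPred 3 fun q : ℕ × (List Bool × ℕ) × (List Bool × ℕ) =>
      GenericStep q.1 q.2.1 q.2.2 := by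
  refine .and ?_ (.and ?_ (.and (.of_pi ?_) (.and (.of_pi ?_) ?_)))
  · exact (sigmaPred_stringExt (by fun_prop) (by fun_prop) (by fun_prop)).mono (by norm_num)
  · exact .ex (.and (.le (by fun_prop) (by fun_prop)) (.eq (by fun_prop) (by fun_prop)))
  · simp only [not_forall]
    refine .ex (SigmaPred.of_iff (.and
      (SigmaPred.succ (sigmaPred_univRE_comp (by fun_prop) (by fun_prop)))
      (.of_pi ?_)) fun _ => exists_prop)
    simp only [not_not]
    exact sigmaPred_univRE_comp (by fun_prop) (by fun_prop)
  · simp only [InfiniteRE, not_forall]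
    exact .exists_not (.ex (.and (.le (by fun_prop) (by fun_prop))
      (sigmaPred_univRE_comp (by fun_prop) (by fun_prop))))
  · have := computable_requirement
    exact (sigmaPred_forces (by fun_prop) (by fun_prop) (by fun_prop)).succ

/-! ### Density: every requirement can be met below every condition. -/

theorem exists_step_of_univRE {x : ℕ} (hx : InfiniteRE x) (σ : List Bool) :
    ∃ ρ, StringExt x σ ρ ∧ ∃ i, σ.length ≤ i ∧ ρ[i]? = some true := by
  obtain ⟨y, hy, h⟩ := hx σ.length
  refine ⟨_, StringExt.concat_true hy h, y, hy, ?_⟩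
  rw [List.getElem?_append_right hy, List.getElem?_append_right (by simp)]
  simp

/-- If no extension of `σ` within the reservoir `x` meets the requirement outright, then the
reservoir can be thinned so that the `d`-th operator omits a nonelement. -/
theorem exists_forcesOmits {e d x : ℕ} {α σ : List Bool}
    (h : ∀ ρ, StringExt x σ ρ →
      ¬ ForcesNotSubset e ρ ∧ ¬ ForcesFinite e ρ x ∧ ¬ ForcesWrong e d α ρ) :
    ∃ ρ x', StringExt x σ ρ ∧ (∀ y, UnivRE x' y → UnivRE x y) ∧ InfiniteRE x' ∧
      ForcesOmits d α ρ x' := by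
  have hStep : SigmaPred 1 fun q : ℕ × (List Bool × ℕ) × (List Bool × ℕ) =>
      StringExt x q.2.1.1 q.2.2.1 ∧ q.2.1.1.length ≤ q.2.2.2 ∧ q.2.2.2 < q.2.2.1.length ∧
        EnumBy e q.2.2.1 q.2.2.2 :=
    .and (sigmaPred_stringExt (by fun_prop) (by fun_prop) (by fun_prop))
      (.and (.le (by fun_prop) (by fun_prop)) (.and (.lt (by fun_prop) (by fun_prop))
        (sigmaPred_enumBy (by fun_prop) (by fun_prop) (by fun_prop))))
  obtain ⟨s, hs₀, hgood, hs, hgraph⟩ := SigmaPred.exists_run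
    (Step := fun _ c c' => StringExt x c.1 c'.1 ∧ c.1.length ≤ c'.2 ∧ c'.2 < c'.1.length ∧
      EnumBy e c'.1 c'.2)
    hStep (Good := fun c => StringExt x σ c.1) (c₀ := (σ, 0)) (fun _ c hc => by
      obtain ⟨-, hf, -⟩ := h c.1 hc
      obtain ⟨⟨n, ρ⟩, hn, hρ, he⟩ := not_not.1 (not_exists.1 hf c.1.length)
      -- Since `ForcesFinite` fails, `e` enumerates some `n` past the current length. The padding
      -- makes the new string long enough to decide `n`.
      exact ⟨(ρ ++ List.replicate (n + 1) false, n), hρ.trans (.replicate_false _ _ _), hn,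
        by simp; omega, he.append _⟩) (fun _ c c' hc hcc => hc.trans hcc.1) (.refl x σ)
  have hmono : ∀ k j, StringExt x (s k).1 (s (k + j)).1 := by
    intro k j
    induction j with
    | zero => exact .refl _ _
    | succ j ih => exact ih.trans (hs (k + j)).1
  -- Each enumerated number is decided, and deciding it negatively would give `ForcesNotSubset`.
  have htrue : ∀ k, (s (k + 1)).1[(s (k + 1)).2]? = some true := by
    intro k
    obtain ⟨-, -, hlt, he⟩ := hs k
    have hf := (h _ (hgood (k + 1))).1
    cases hb : (s (k + 1)).1[(s (k + 1)).2] with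
    | true => rw [List.getElem?_eq_getElem hlt, hb]
    | false => exact absurd ⟨_, by rw [List.getElem?_eq_getElem hlt, hb], he⟩ hf
  have hlen : ∀ k, k ≤ (s k).1.length := by
    intro k
    induction k with
    | zero => exact Nat.zero_le _
    | succ k ih =>
      have := hs k
      omega
  -- The new reservoir consists of the numbers enumerated along the run; it is r.e. because the
  -- graph of the run is `Σ⁰₁`.
  obtain ⟨x', hx'⟩ := SigmaPred.exists_univRE
    (P := fun y : ℕ => ∃ q : ℕ × List Bool, s (q.1 + 1) = (q.2, y))
    (.ex (hgraph.comp (f := fun q : ℕ × ℕ × List Bool => (q.2.1 + 1, q.2.2, q.1)) (by fun_prop)))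
  replace hx' : ∀ y, UnivRE x' y ↔ ∃ k, (s (k + 1)).2 = y := by
    intro y
    rw [show UnivRE x' y ↔ _ from (hx' y).symm]
    constructor
    · rintro ⟨q, hq⟩
      exact ⟨q.1, by simp [hq]⟩
    · rintro ⟨k, hk⟩
      exact ⟨(k, (s (k + 1)).1), by simp [← hk]⟩
  -- The omitted number is `(s 1).2`: an element of every later string of the run, but padded out of
  -- the condition returned here.
  refine ⟨σ ++ List.replicate ((s 1).2 + 1) false, x', .replicate_false _ _ _, ?_, ?_,
    (s 1).2, ?_, ?_⟩
  · intro y hy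
    obtain ⟨k, rfl⟩ := (hx' y).1 hy
    exact (hs k).1.univRE (hs k).2.1 (htrue k)
  · exact fun b => ⟨_, (hlen b).trans (hs b).2.1, (hx' _).2 ⟨b, rfl⟩⟩
  · have := (hs 0).2.1
    rw [hs₀] at this
    rw [List.getElem?_append_right (by simpa using this)]
    simp
  · rintro ⟨_, ⟨β, rfl, hβ⟩, hd⟩
    -- A late enough string of the run enumerates all elements of `β`, hence witnesses the excluded
    -- `ForcesWrong`.
    have hev : ∀ i ∈ Set.Iio β.length, ∀ᶠ j in atTop, β[i]? = some true →
        EnumBy e (s (1 + j)).1 (α.length + i) := by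
      intro i hi
      by_cases hb : β[i]? = some true
      · obtain ⟨k, hk⟩ := (hx' _).1 (hβ i hi hb)
        filter_upwards [eventually_ge_atTop k] with j hj _
        obtain ⟨l, rfl⟩ := Nat.exists_eq_add_of_le hj
        rw [← hk, show 1 + (k + l) = k + 1 + l by omega]
        exact (hs k).2.2.2.stringExt (hmono _ _)
      · simp [hb]
    obtain ⟨j, hj⟩ := ((eventually_all_finite (Set.finite_Iio β.length)).2 hev).exists
    exact (h _ (hgood (1 + j))).2.2
      ⟨(β, (s 1).2), fun i hi => hj i hi, hd, (hmono 1 j).getElem? (htrue 0)⟩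

theorem exists_genericStep (k : ℕ) {c : List Bool × ℕ} (hc : InfiniteRE c.2) :
    ∃ c', GenericStep k c c' := by
  obtain ⟨σ, hσ, i, hi, hσi⟩ := exists_step_of_univRE hc c.1
  generalize hr : requirement k = r
  by_cases h : ∃ ρ, StringExt c.2 σ ρ ∧ (ForcesNotSubset r.1 ρ ∨ ForcesFinite r.1 ρ c.2 ∨
      ForcesWrong r.1 r.2.1 r.2.2 ρ)
  · obtain ⟨ρ, hρ, hf⟩ := h
    refine ⟨(ρ, c.2), hσ.trans hρ, ⟨i, hi, hρ.getElem? hσi⟩, fun y => id, hc, ?_⟩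
    rw [hr]
    rcases hf with hf | hf | hf
    exacts [.inl hf, .inr (.inl hf), .inr (.inr (.inl hf))]
  · simp only [not_exists, not_and, not_or] at h
    obtain ⟨ρ, x', hρ, hx', hinf, hf⟩ := exists_forcesOmits h
    refine ⟨(ρ, x'), hσ.trans hρ, ⟨i, hi, hρ.getElem? hσi⟩, hx', hinf, ?_⟩
    rw [hr]
    exact .inr (.inr (.inr hf))

theorem exists_infiniteRE : ∃ x, InfiniteRE x := by
  obtain ⟨x, hx⟩ := SigmaPred.exists_univRE (P := fun n : ℕ => n = n)
    (.eq (by fun_prop) (by fun_prop))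
  exact ⟨x, fun b => ⟨b, le_rfl, (hx b).1 rfl⟩⟩

/-! ### The generic set. -/

theorem SigmaPred.isDeltaThree {A : Set ℕ} (h₁ : SigmaPred 3 fun n => n ∈ A)
    (h₂ : SigmaPred 3 fun n => n ∉ A) : IsDeltaThree A := by
  have key : ∀ P : ℕ → Prop, SigmaPred 3 P → ∃ R : ℕ × ℕ × ℕ × ℕ → Prop, ComputablePred R ∧
      ∀ n, P n ↔ ∃ x, ∀ y, ∃ z, R (n, x, y, z) := by
    rintro P ⟨Q₁, ⟨Q₂, ⟨Q₃, hQ₃, h₃⟩, h₂⟩, h₁⟩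
    refine ⟨fun q => ¬ Q₃ (((q.1, q.2.1), q.2.2.1), q.2.2.2), ComputablePred.not
      (ComputablePred.comp hQ₃ (f := fun q : ℕ × ℕ × ℕ × ℕ => (((q.1, q.2.1), q.2.2.1), q.2.2.2))
        (by fun_prop)), fun n => ?_⟩
    simp only [h₁, h₂, h₃, not_exists, not_not, not_forall]
  refine ⟨key _ h₁, ?_⟩
  obtain ⟨R, hR, h⟩ := key _ h₂
  refine ⟨fun q => ¬ R q, hR.not, fun n => ?_⟩
  simpa using not_congr (h n)

theorem stringExt_initSeg {A : Set ℕ} {σ : List Bool} {x N : ℕ} (hσ : σ = initSeg A σ.length)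
    (hx : ∀ n ∈ A, σ.length ≤ n → UnivRE x n) (hN : σ.length ≤ N) :
    StringExt x σ (initSeg A N) := by
  obtain ⟨M, rfl⟩ := Nat.exists_eq_add_of_le hN
  obtain ⟨β, hβ⟩ := initSeg_add A σ.length M
  rw [← hσ] at hβ
  refine ⟨β, hβ, fun i hi h => hx _ ?_ (by omega)⟩
  have : (initSeg A (σ.length + M))[σ.length + i]? = some true := by
    rw [hβ, List.getElem?_append_right (by omega)]
    simpa using h
  exact ((initSeg_getElem? _ _ _ _).1 this).2.1 rfl

/-- A `Δ⁰₃` set that is sufficiently generic for Mathias forcing with recursively enumerable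
reservoirs. -/
theorem exists_generic : ∃ G : Set ℕ, G.Infinite ∧ IsDeltaThree G ∧ ∀ r, ∃ σ x,
    σ = initSeg G σ.length ∧ (∀ n ∈ G, σ.length ≤ n → UnivRE x n) ∧ Forces r σ x := by
  obtain ⟨x₀, hx₀⟩ := exists_infiniteRE
  obtain ⟨s, -, -, hs, hgraph⟩ := SigmaPred.exists_run sigmaPred_genericStep
    (Good := fun c => InfiniteRE c.2) (c₀ := ([], x₀)) (fun k _ hc => exists_genericStep k hc)
    (fun _ _ _ _ h => h.2.2.2.1) hx₀
  have hsub : ∀ k j y, UnivRE (s (k + j)).2 y → UnivRE (s k).2 y := by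
    intro k j
    induction j with
    | zero => exact fun _ => id
    | succ j ih => exact fun y hy => ih y ((hs (k + j)).2.2.1 y hy)
  have hmono : ∀ k j, StringExt (s k).2 (s k).1 (s (k + j)).1 := by
    intro k j
    induction j with
    | zero => exact .refl _ _
    | succ j ih => exact ih.trans ((hs (k + j)).1.mono (hsub k j))
  have hlen : ∀ k, k ≤ (s k).1.length := by
    intro k
    induction k with
    | zero => exact Nat.zero_le _
    | succ k ih =>
      obtain ⟨i, hi, hi'⟩ := (hs k).2.1
      have := (List.getElem?_eq_some_iff.1 hi').1
      omega
  have hseg := eq_initSeg_stringUnion (s := fun k => (s k).1) fun k => by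
    obtain ⟨β, hβ, -⟩ := (hs k).1
    exact ⟨β, hβ.symm⟩
  generalize hG : stringUnion (fun k => (s k).1) = G at hseg
  -- Membership and nonmembership are both read off some stage of the run, so both are `Σ⁰₃`.
  have hmem : ∀ (n : ℕ) (b : Bool), (b = true ↔ n ∈ G) ↔
      ∃ q : ℕ × List Bool × ℕ, s q.1 = q.2 ∧ q.2.1[n]? = some b := by
    intro n b
    constructor
    · intro h
      refine ⟨(n + 1, s (n + 1)), rfl, ?_⟩
      dsimp only
      rw [hseg]
      exact (initSeg_getElem? _ _ _ _).2 ⟨hlen (n + 1), h⟩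
    · rintro ⟨q, hq, h⟩
      rw [← hq, hseg] at h
      exact ((initSeg_getElem? _ _ _ _).1 h).2
  have hsig : ∀ b : Bool, SigmaPred 3 fun n : ℕ =>
      ∃ q : ℕ × List Bool × ℕ, s q.1 = q.2 ∧ q.2.1[n]? = some b := fun b =>
    .ex (.and (hgraph.comp (f := fun q : ℕ × ℕ × List Bool × ℕ => q.2) (by fun_prop))
      (.eq (by fun_prop) (by fun_prop)))
  have hres : ∀ k, ∀ n ∈ G, (s k).1.length ≤ n → UnivRE (s k).2 n := by
    intro k n hn hkn
    refine (hmono k (n + 1)).univRE hkn ?_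
    rw [hseg]
    exact (initSeg_getElem? _ _ _ _).2 ⟨(hlen (k + (n + 1))).trans_lt' (by omega), by simpa⟩
  refine ⟨G, Set.infinite_of_forall_exists_gt fun b => ?_, SigmaPred.isDeltaThree ?_ ?_,
    fun r => ?_⟩
  · obtain ⟨i, hi, hi'⟩ := (hs (b + 1)).2.1
    exact ⟨i, hG ▸ ⟨_, hi'⟩, (hlen (b + 1)).trans hi⟩
  · exact (hsig true).of_iff fun n => by simpa using hmem n true
  · exact (hsig false).of_iff fun n => by simpa using hmem n false
  · have hk := (hs (Encodable.encode r)).2.2.2.2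
    rw [show requirement (Encodable.encode r) = r by simp [requirement]] at hk
    exact ⟨_, _, hseg (Encodable.encode r + 1), hres _, hk⟩

/-! ### Subsets that do not enumerate the complement of the generic set. -/

theorem exists_concat_true {S : Set ℕ} (hS : S.Infinite) {α : List Bool}
    (hα : ∀ i, α[i]? = some true → i ∈ S) :
    ∃ β, (∀ i, (α ++ β)[i]? = some true → i ∈ S) ∧
      ∃ i, α.length ≤ i ∧ (α ++ β)[i]? = some true := by
  obtain ⟨y, hyS, hy⟩ := hS.exists_gt α.length
  have hl : (α ++ List.replicate (y - α.length) false).length = y := by simp; omega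
  refine ⟨List.replicate (y - α.length) false ++ [true], fun i hi => ?_, y, hy.le, ?_⟩
  · rw [← List.append_assoc] at hi
    rcases lt_trichotomy i y with h | rfl | h
    · rw [List.getElem?_append_left (by omega)] at hi
      by_cases hiα : i < α.length
      · rw [List.getElem?_append_left hiα] at hi
        exact hα i hi
      · rw [List.getElem?_append_right (by omega)] at hi
        simp [List.getElem?_replicate] at hi
    · exact hyS
    · rw [List.getElem?_eq_none (by simp; omega)] at hi
      simp at hi
  · rw [← List.append_assoc, List.getElem?_append_right (by omega)]
    simp [hl]

theorem enumBy_initSeg_mono {A : Set ℕ} {d m N N' : ℕ} (h : EnumBy d (initSeg A N) m)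
    (hN : N ≤ N') : EnumBy d (initSeg A N') m := by
  obtain ⟨M, rfl⟩ := Nat.exists_eq_add_of_le hN
  obtain ⟨β, hβ⟩ := initSeg_add A N M
  exact hβ ▸ h.append β

/-- One step in the construction of a subset of `S` that does not enumerate the complement
of `G`. -/
theorem exists_extension_not_enum {G S : Set ℕ}
    (hG : ∀ r, ∃ σ x, σ = initSeg G σ.length ∧ (∀ n ∈ G, σ.length ≤ n → UnivRE x n) ∧
      Forces r σ x)
    (hSG : S ⊆ G) (hS : S.Infinite) {e : ℕ} (he : ∀ n, n ∈ S ↔ ∃ N, EnumBy e (initSeg G N) n)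
    (d : ℕ) {α : List Bool} (hα : ∀ i, α[i]? = some true → i ∈ S) :
    ∃ β, (∀ i, (α ++ β)[i]? = some true → i ∈ S) ∧
      (∃ i, α.length ≤ i ∧ (α ++ β)[i]? = some true) ∧
      ∀ T ⊆ S, α ++ β = initSeg T (α ++ β).length →
        ¬ ∀ m, m ∉ G ↔ ∃ N, EnumBy d (initSeg T N) m := by
  obtain ⟨σ, x, hσ, hx, hf⟩ := hG (e, d, α)
  have hmem : ∀ n b, σ[n]? = some b → (b = true ↔ n ∈ G) := fun n b h => by
    rw [hσ] at h
    exact ((initSeg_getElem? _ _ _ _).1 h).2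
  -- The first two alternatives contradict `S ⊆ G` and the infinitude of `S`. The third gives a `β`
  -- inside `S` that makes `d` err; in the fourth, `d` never enumerates `m`.
  rcases hf with ⟨n, hn, hen⟩ | ⟨k, hk⟩ | ⟨⟨β, m⟩, hβ, hd, hm⟩ | ⟨m, hm, hd⟩
  · have : n ∈ G := hSG ((he n).2 ⟨_, hσ ▸ hen⟩)
    simpa using (hmem n _ hn).2 this
  · obtain ⟨n, hnS, hn⟩ := hS.exists_gt k
    obtain ⟨N, hN⟩ := (he n).1 hnS
    exact absurd ⟨(n, initSeg G (max N σ.length)), hn.le,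
      stringExt_initSeg hσ hx (le_max_right _ _), enumBy_initSeg_mono hN (le_max_left _ _)⟩ hk
  · have hαβ : ∀ i, (α ++ β)[i]? = some true → i ∈ S := by
      intro i hi
      by_cases hiα : i < α.length
      · rw [List.getElem?_append_left hiα] at hi
        exact hα i hi
      · rw [List.getElem?_append_right (by omega)] at hi
        have := hβ _ (List.getElem?_eq_some_iff.1 hi).1 hi
        rw [show α.length + (i - α.length) = i by omega] at this
        exact (he i).2 ⟨_, hσ ▸ this⟩
    obtain ⟨γ, hγS, i, hi, hiγ⟩ := exists_concat_true hS hαβ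
    rw [List.append_assoc] at hγS hiγ
    refine ⟨β ++ γ, hγS, ⟨i, by simp at hi; omega, hiγ⟩, fun T _ hT h => ?_⟩
    rw [← List.append_assoc] at hT
    exact (h m).2 ⟨_, initSeg_eq_append hT.symm ▸ hd⟩ ((hmem m _ hm).1 rfl)
  -- Padding `α` by `σ.length` zeros forces new elements of `T` past `σ`, where elements of `G` lie
  -- in the reservoir.
  · have hα' : ∀ i, (α ++ List.replicate σ.length false)[i]? = some true → i ∈ S := by
      intro i hi
      by_cases hiα : i < α.length
      · rw [List.getElem?_append_left hiα] at hi
        exact hα i hi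
      · rw [List.getElem?_append_right (by omega)] at hi
        simp [List.getElem?_replicate] at hi
    obtain ⟨γ, hγS, i, hi, hiγ⟩ := exists_concat_true hS hα'
    rw [List.append_assoc] at hγS hiγ
    refine ⟨_, hγS, ⟨i, by simp at hi; omega, hiγ⟩, fun T hTS hT h => ?_⟩
    obtain ⟨N, hN⟩ := (h m).1 fun hmG => by simpa using (hmem m _ hm).2 hmG
    refine hd ⟨initSeg T (max N α.length), stringExt_initSeg (initSeg_eq_append hT.symm)
      (fun n hn hαn => hx n (hSG (hTS hn)) (not_lt.1 fun hlt => ?_)) (le_max_right _ _),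
      enumBy_initSeg_mono hN (le_max_left _ _)⟩
    have : (α ++ (List.replicate σ.length false ++ γ))[n]? = some true := by
      rw [hT]
      exact (initSeg_getElem? _ _ _ _).2 ⟨by simp; omega, by simpa⟩
    rw [List.getElem?_append_right hαn, List.getElem?_append_left (by simp; omega)] at this
    simp [List.getElem?_replicate] at this

/-- Stage `d` of a finite-extension construction defeats the `d`-th operator and adds an element. No
effectiveness of `T` is needed. -/
theorem exists_subset_not_enum {G S : Set ℕ}
    (hG : ∀ r, ∃ σ x, σ = initSeg G σ.length ∧ (∀ n ∈ G, σ.length ≤ n → UnivRE x n) ∧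
      Forces r σ x)
    (hSG : S ⊆ G) (hS : S.Infinite) {e : ℕ} (he : ∀ n, n ∈ S ↔ ∃ N, EnumBy e (initSeg G N) n) :
    ∃ T ⊆ S, T.Infinite ∧ ∀ d, ¬ ∀ m, m ∉ G ↔ ∃ N, EnumBy d (initSeg T N) m := by
  choose! F hF using fun d α hα => exists_extension_not_enum hG hSG hS he d (α := α) hα
  let s : ℕ → List Bool := fun k => Nat.rec [] (fun k α => α ++ F k α) k
  have hs : ∀ k, ∀ i, (s k)[i]? = some true → i ∈ S := by
    intro k
    induction k with
    | zero => simp [s]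
    | succ k ih => exact (hF k _ ih).1
  have hlen : ∀ k, k ≤ (s k).length := by
    intro k
    induction k with
    | zero => exact Nat.zero_le _
    | succ k ih =>
      obtain ⟨i, hi, hi'⟩ := (hF k _ (hs k)).2.1
      exact (ih.trans hi).trans_lt (List.getElem?_eq_some_iff.1 hi').1
  have hseg := eq_initSeg_stringUnion (s := s) fun k => List.prefix_append _ _
  have hTS : stringUnion s ⊆ S := fun n ⟨k, hk⟩ => hs k n hk
  refine ⟨stringUnion s, hTS, Set.infinite_of_forall_exists_gt fun b => ?_, fun d =>
    (hF d _ (hs d)).2.2 _ hTS (hseg (d + 1))⟩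
  obtain ⟨i, hi, hi'⟩ := (hF (b + 1) _ (hs (b + 1))).2.1
  exact ⟨i, ⟨b + 2, hi'⟩, (hlen (b + 1)).trans hi⟩

/-- `V` need not be monotone: `EnumBy` looks at all prefixes, and a prefix of an initial segment is
again one. -/
theorem SigmaPred.exists_enumBy {V : List Bool → ℕ → Prop}
    (hV : SigmaPred 1 fun q : List Bool × ℕ => V q.1 q.2) (A : Set ℕ) :
    ∃ e, ∀ n, (∃ N, V (initSeg A N) n) ↔ ∃ N, EnumBy e (initSeg A N) n := by
  obtain ⟨e, he⟩ := hV.exists_univRE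
  refine ⟨e, fun n => ⟨fun ⟨N, hN⟩ => ⟨N, (initSeg A N, []), by simp, (he _).1 hN⟩, ?_⟩⟩
  rintro ⟨N, ⟨ρ, β⟩, hq, h⟩
  exact ⟨ρ.length, initSeg_eq_append hq ▸ (he (ρ, n)).2 h⟩

theorem EnumGraph.exists_enumBy {A : Set ℕ} {f : ℕ →. ℕ} (hf : EnumGraph A f) (v : ℕ) :
    ∃ e, ∀ n, v ∈ f n ↔ ∃ N, EnumBy e (initSeg A N) n := by
  obtain ⟨V, hV, -, hVf⟩ := hf
  obtain ⟨e, he⟩ := SigmaPred.exists_enumBy (V := fun ρ n => V ρ n v)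
    (hV.comp₃ (by fun_prop) (by fun_prop) (by fun_prop)) A
  exact ⟨e, fun n => (hVf n v).trans (he n)⟩

theorem one_mem_charFun {A : Set ℕ} {n : ℕ} : 1 ∈ charFun A n ↔ n ∈ A := by
  by_cases h : n ∈ A <;> simp [charFun, h]

theorem zero_mem_charFun {A : Set ℕ} {n : ℕ} : 0 ∈ charFun A n ↔ n ∉ A := by
  by_cases h : n ∈ A <;> simp [charFun, h]

/-! ### Sparse subsets, for the modulus argument. -/

/-- The next element of `A` after `x` that bounds `f` on `[0, x]` is found by enumeration. -/
theorem EnumGraph.exists_next {A : Set ℕ} (hA : A.Infinite) {f : ℕ → ℕ}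
    (hf : EnumGraph A fun n => Part.some (f n)) :
    ∃ g : ℕ → ℕ, (∀ x, g x ∈ A ∧ x < g x ∧ ∀ j < x + 1, f j ≤ g x) ∧
      EnumGraph A fun n => Part.some (g n) := by
  classical
  obtain ⟨V, hV, hVm, hVf⟩ := hf
  simp only [Part.mem_some_iff] at hVf
  have hex : ∀ x, ∃ y, y ∈ A ∧ x < y ∧ ∀ j < x + 1, f j ≤ y := by
    intro x
    obtain ⟨y, hy, hlt⟩ := hA.exists_gt (x + ∑ j ∈ Finset.range (x + 1), f j)
    refine ⟨y, hy, by omega, fun j hj => ?_⟩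
    have := Finset.single_le_sum (f := f) (fun _ _ => Nat.zero_le _) (Finset.mem_range.2 hj)
    omega
  have hget : ∀ (ρ β : List Bool) (n : ℕ) (b : Bool), ρ[n]? = some b → (ρ ++ β)[n]? = some b :=
    fun ρ β n b h => List.getElem?_append_left (List.getElem?_eq_some_iff.1 h).1 ▸ h
  have hVev : ∀ j, ∀ᶠ N in atTop, V (initSeg A N) j (f j) := fun j =>
    eventually_of_mem (f := fun n => Part.some (f n)) hVm (by simpa using hVf) (by simp)
  refine ⟨fun x => Nat.find (hex x), fun x => Nat.find_spec (hex x), fun ρ x y =>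
    (ρ[y]? = some true ∧ x < y ∧ ∀ j < x + 1, ∃ v, V ρ j v ∧ v ≤ y) ∧
      -- Minimality of `y` is expressed positively: each smaller `z` visibly fails one of the three
      -- clauses.
      ∀ z < y, ρ[z]? = some false ∨ z ≤ x ∨ ∃ q : ℕ × ℕ, q.1 < x + 1 ∧ V ρ q.1 q.2 ∧ z < q.2,
    ?_, ?_, fun x y => ?_⟩
  · refine .and (.and (.eq (by fun_prop) (by fun_prop)) (.and (.lt (by fun_prop) (by fun_prop))
      (SigmaPred.forall_lt (.ex ?_) (by fun_prop))))
      (SigmaPred.forall_lt (.or (.eq (by fun_prop) (by fun_prop)) (.or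
        (.le (by fun_prop) (by fun_prop)) (.ex ?_))) (by fun_prop))
    · exact .and (hV.comp₃ (by fun_prop) (by fun_prop) (by fun_prop))
        (.le (by fun_prop) (by fun_prop))
    · exact .and (.lt (by fun_prop) (by fun_prop))
        (.and (hV.comp₃ (by fun_prop) (by fun_prop) (by fun_prop))
          (.lt (by fun_prop) (by fun_prop)))
  · rintro ρ β x y ⟨⟨h₁, h₂, h₃⟩, h₄⟩
    refine ⟨⟨hget _ _ _ _ h₁, h₂, fun j hj => ?_⟩, fun z hz => ?_⟩
    · obtain ⟨v, hv, hvy⟩ := h₃ j hj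
      exact ⟨v, hVm _ _ _ _ hv, hvy⟩
    · rcases h₄ z hz with h | h | ⟨q, hq, h, hzq⟩
      exacts [.inl (hget _ _ _ _ h), .inr (.inl h), .inr (.inr ⟨q, hq, hVm _ _ _ _ h, hzq⟩)]
  · rw [Part.mem_some_iff, eq_comm, Nat.find_eq_iff]
    constructor
    · rintro ⟨⟨h₁, h₂, h₃⟩, h₄⟩
      obtain ⟨N, hN, hyN⟩ := (((eventually_all_finite (Set.finite_Iio (x + 1))).2
        fun j _ => hVev j).and (eventually_gt_atTop y)).exists
      refine ⟨N, ⟨(initSeg_getElem? _ _ _ _).2 ⟨hyN, by simpa⟩, h₂, fun j hj =>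
        ⟨f j, hN j hj, h₃ j hj⟩⟩, fun z hz => ?_⟩
      by_contra! h
      obtain ⟨h₅, h₆, h₇⟩ := h
      refine h₄ z hz ⟨?_, h₆, fun j hj => h₇ (j, f j) hj (hN j hj)⟩
      by_contra hzA
      exact h₅ ((initSeg_getElem? _ _ _ _).2 ⟨hz.trans hyN, by simpa⟩)
    · rintro ⟨N, ⟨h₁, h₂, h₃⟩, h₄⟩
      refine ⟨⟨((initSeg_getElem? _ _ _ _).1 h₁).2.1 rfl, h₂, fun j hj => ?_⟩, fun z hz h => ?_⟩
      · obtain ⟨v, hv, hvy⟩ := h₃ j hj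
        exact (hVf j v).2 ⟨N, hv⟩ ▸ hvy
      · rcases h₄ z hz with h₅ | h₅ | ⟨q, hq, h₅, hzq⟩
        · simpa using ((initSeg_getElem? _ _ _ _).1 h₅).2.2 h.1
        · exact absurd h.2.1 (not_lt.2 h₅)
        · have := h.2.2 q.1 hq
          rw [← (hVf _ _).2 ⟨N, h₅⟩] at this
          omega

theorem EnumGraph.iterate {A : Set ℕ} {g : ℕ → ℕ} (hg : EnumGraph A fun n => Part.some (g n)) :
    EnumGraph A fun k => Part.some (g^[k] 0) := by
  have h := (EnumGraph.prec (EnumGraph.of_computable (Computable.const 0))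
    (hg.comp (EnumGraph.of_computable (g := fun p => p.unpair.2.unpair.2) (by fun_prop)))).comp
    (EnumGraph.of_computable (g := fun k => Nat.pair 0 k) (by fun_prop))
  refine (congrArg (EnumGraph A) (funext fun k => ?_)).mp h
  simp only [Part.bind_eq_bind, Part.bind_some, Nat.unpair_pair]
  induction k with
  | zero => rfl
  | succ k ih => simp only [ih, Part.bind_some, Function.iterate_succ_apply']

/-- Every infinite set `A` has an infinite subset, enumerated relative to `A`, any two elements
`s < t` of which satisfy `f ≤ t` on `[0, s]`. -/
theorem EnumGraph.exists_sparse {A : Set ℕ} (hA : A.Infinite) {f : ℕ → ℕ}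
    (hf : EnumGraph A fun n => Part.some (f n)) :
    ∃ S ⊆ A, S.Infinite ∧ (∃ e, ∀ n, n ∈ S ↔ ∃ N, EnumBy e (initSeg A N) n) ∧
      ∀ s ∈ S, ∀ t ∈ S, s < t → ∀ j ≤ s, f j ≤ t := by
  obtain ⟨g, hg, hgA⟩ := exists_next hA hf
  have hmono : StrictMono fun k => g^[k] 0 := strictMono_nat_of_lt_succ fun k => by
    rw [Function.iterate_succ_apply']
    exact (hg _).2.1
  obtain ⟨V, hV, -, hVg⟩ := hgA.iterate
  obtain ⟨e, he⟩ := SigmaPred.exists_enumBy (V := fun ρ n => ∃ k, V ρ (k + 1) n)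
    (.ex (hV.comp₃ (by fun_prop) (by fun_prop) (by fun_prop))) A
  -- The orbit is taken from its first iterate on, since the starting point 0 need not lie in `A`.
  refine ⟨Set.range fun k => g^[k + 1] 0, ?_, Set.infinite_range_of_injective fun i j h => ?_,
    ⟨e, fun n => ?_⟩, ?_⟩
  · rintro _ ⟨k, rfl⟩
    simp only [Function.iterate_succ_apply']
    exact (hg _).1
  · simpa using hmono.injective h
  · rw [← he, exists_comm]
    refine exists_congr fun k => ?_
    rw [← hVg, Part.mem_some_iff, eq_comm]
  · rintro _ ⟨a, rfl⟩ _ ⟨b, rfl⟩ hlt j hj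
    have hab : a + 1 ≤ b := by
      have := hmono.lt_iff_lt.1 hlt
      omega
    have := (hg (g^[b] 0)).2.2 j (Nat.lt_succ_of_le (hj.trans (hmono.monotone hab)))
    simpa only [Function.iterate_succ_apply'] using this

/-! ### The main theorem. -/

theorem mainTheorem3 :
    ∃ G : Set ℕ, G.Infinite ∧ IsDeltaThree G ∧
      (∀ S : Set ℕ, S ⊆ G → S.Infinite → SetTuringReducible S G →
        ∃ T : Set ℕ, T ⊆ S ∧ T.Infinite ∧ ¬ SetTuringReducible G T) ∧
      (¬ ∃ S : Set ℕ, S ⊆ G ∧ IsIntroreducible S ∧ SetTuringEquivalent S G) ∧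
      (¬ ∃ f : ℕ → ℕ, IsModulus f G ∧
        TuringEquivalent (fun n => Part.some (f n)) (charFun G)) := by
  obtain ⟨G, hinf, hdelta, hG⟩ := exists_generic
  have hnot : ∀ T : Set ℕ, (∀ d, ¬ ∀ m, m ∉ G ↔ ∃ N, EnumBy d (initSeg T N) m) →
      ¬ EnumGraph T (charFun G) := by
    intro T hT h
    obtain ⟨d, hd⟩ := h.exists_enumBy 0
    exact hT d fun m => zero_mem_charFun.symm.trans (hd m)
  have hmain : ∀ S : Set ℕ, S ⊆ G → S.Infinite → SetTuringReducible S G →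
      ∃ T : Set ℕ, T ⊆ S ∧ T.Infinite ∧ ¬ SetTuringReducible G T := by
    intro S hSG hS hred
    obtain ⟨e, he⟩ := (EnumGraph.of_turingReducible hred .charFun_self).exists_enumBy 1
    obtain ⟨T, hTS, hT, hTG⟩ := exists_subset_not_enum hG hSG hS
      fun n => one_mem_charFun.symm.trans (he n)
    exact ⟨T, hTS, hT, fun h => hnot T hTG (.of_turingReducible h .charFun_self)⟩
  refine ⟨G, hinf, hdelta, hmain, ?_, ?_⟩
  · rintro ⟨S, hSG, ⟨hS, hintro⟩, hle, hge⟩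
    obtain ⟨T, hTS, hT, hTG⟩ := hmain S hSG hS hle
    exact hTG (TuringReducible.trans hge (hintro T hTS hT))
  · rintro ⟨f, hmod, hf, -⟩
    obtain ⟨S, hSG, hS, ⟨e, he⟩, hsparse⟩ :=
      EnumGraph.exists_sparse hinf (.of_turingReducible hf .charFun_self)
    obtain ⟨T, hTS, hT, hTG⟩ := exists_subset_not_enum hG hSG hS he
    -- With bound 0, `g` simply gives the next element of `T`.
    obtain ⟨g, hg, hgT⟩ := EnumGraph.exists_next hT (f := fun _ => 0)
      (.of_computable (Computable.const 0))
    refine hnot T hTG (.of_turingReducible (hmod (fun n => g (g n)) fun n => ?_) ?_)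
    -- Here `n < g n < g (g n)` with both values in `S`, so sparseness gives `f n ≤ g (g n)`. Thus
    -- `T` would compute `G` through the modulus.
    · exact hsparse _ (hTS (hg n).1) _ (hTS (hg (g n)).1) (hg (g n)).2.1 n (hg n).2.1.le
    · have h := hgT.comp hgT
      simpa only [Part.bind_eq_bind, Part.bind_some] using h
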